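/- For $k\in\mathbb N=\{0,1,2,\dots\}$ let $J_k$ and $I_k$ denote the Bessel function and the modified Bessel function of the first kind of order $k$. Let $\kappa>0$, $k\in\mathbb N$ and let $\ell\ge 1$ be an integer. Let $\alpha_{k,\ell}=\alpha_{k,\ell}(\kappa)$ be the $\ell$-th positive root, in increasing order, of $$F_k(\alpha)=\frac{\kappa}{\alpha}\,J_k(\alpha)\,I_k'\Bigl(\frac{\kappa}{\alpha}\Bigr)-\alpha\, I_k\Bigl(\frac{\kappa}{\alpha}\Bigr)J_k'(\alpha),\qquad \alpha>0$$ (this root exists: there is a positive root of $F_k$ below which $F_k$ has exactly $\ell-1$ positive roots). Let $(c,d)\in\mathbb R^2\setminus\{(0,0)\}$ be any solution of the system $$c\,J_k(\alpha_{k,\ell})+d\,I_k\Bigl(\frac{\kappa}{\alpha_{k,\ell}}\Bigr)=0,\qquad c\,\alpha_{k,\ell}\,J_k'(\alpha_{k,\ell})+d\,\frac{\kappa}{\alpha_{k,\ell}}\,I_k'\Bigl(\frac{\kappa}{\alpha_{k,\ell}}\Bigr)=0,$$ and set $$R_{k,\ell}(r)=c\,J_k(\alpha_{k,\ell}\,r)+d\,I_k\Bigl(\frac{\kappa}{\alpha_{k,\ell}}\,r\Bigr).$$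 Then $R_{k,\ell}$ has exactly $\ell-1$ roots in the open interval $(0,1)$, and all of them are simple, i.e. $R_{k,\ell}'(r)\neq 0$ at each root $r\in(0,1)$. -/

import Mathlib

noncomputable section

/-- The Bessel function of the first kind `J_k` of integer order `k ≥ 0` (on the real line). -/
def besselJ (k : ℕ) (x : ℝ) : ℝ :=
  ∑' m : ℕ, (-1 : ℝ) ^ m / ((m.factorial : ℝ) * ((m + k).factorial : ℝ)) * (x / 2) ^ (2 * m + k)

/-- The modified Bessel function of the first kind `I_k` of integer order `k ≥ 0`
(on the real line). -/
def besselI (k : ℕ) (x : ℝ) : ℝ :=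
  ∑' m : ℕ, 1 / ((m.factorial : ℝ) * ((m + k).factorial : ℝ)) * (x / 2) ^ (2 * m + k)

/-- The characteristic function
`F_k(α) = (κ/α) J_k(α) I_k'(κ/α) - α I_k(κ/α) J_k'(α)` (meaningful for `α > 0`). -/
def bucklingF (κ : ℝ) (k : ℕ) (α : ℝ) : ℝ :=
  κ / α * besselJ k α * deriv (besselI k) (κ / α)
    - α * besselI k (κ / α) * deriv (besselJ k) α

/-- `x` is the `n`-th positive root of `f` in increasing order (`n ≥ 1`): it is a positive root,
and `f` has exactly `n - 1` roots in the interval `(0, x)`. -/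
def IsNthPositiveRoot (f : ℝ → ℝ) (n : ℕ) (x : ℝ) : Prop :=
  0 < x ∧ f x = 0 ∧ {y : ℝ | 0 < y ∧ y < x ∧ f y = 0}.encard + 1 = (n : ℕ∞)

/-- `α_{k,ℓ}(κ)`, the `ℓ`-th positive root of `F_k`. At most one number is the `ℓ`-th positive
root, so the infimum below is that number whenever it exists. -/
def alphaRoot (κ : ℝ) (k ℓ : ℕ) : ℝ :=
  sInf {x : ℝ | IsNthPositiveRoot (bucklingF κ k) ℓ x}

/-- The radial profile `R(r) = c J_k(α r) + d I_k((κ/α) r)`. -/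
def radialProfile (κ : ℝ) (k : ℕ) (α c d : ℝ) (r : ℝ) : ℝ :=
  c * besselJ k (α * r) + d * besselI k (κ / α * r)

/-- The linear system for `(c, d)` expressing the boundary conditions `R(1) = R'(1) = 0`. -/
def BoundaryConditions (κ : ℝ) (k : ℕ) (α c d : ℝ) : Prop :=
  c * besselJ k α + d * besselI k (κ / α) = 0 ∧
    c * α * deriv (besselJ k) α + d * (κ / α) * deriv (besselI k) (κ / α) = 0

end

open Set Filter Topology

/-- The entire function `∑ sᵐ zᵐ / (m! (m+k)!)`. -/
noncomputable def besselSeries (s : ℝ) (k : ℕ) (z : ℝ) : ℝ :=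
  ∑' m : ℕ, s ^ m / ((m.factorial : ℝ) * ((m + k).factorial : ℝ)) * z ^ m

lemma summable_besselSeries (s : ℝ) (k : ℕ) (z : ℝ) :
    Summable fun m : ℕ => s ^ m / ((m.factorial : ℝ) * ((m + k).factorial : ℝ)) * z ^ m := by
  refine Summable.of_norm_bounded (Real.summable_pow_div_factorial (|s| * |z|)) fun m => ?_
  have h1 : (1 : ℝ) ≤ ((m + k).factorial : ℝ) := by exact_mod_cast Nat.one_le_iff_ne_zero.2 (Nat.factorial_ne_zero _)
  have h2 : (0 : ℝ) < (m.factorial : ℝ) := by exact_mod_cast Nat.factorial_pos m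
  simp only [norm_mul, norm_div, norm_pow, Real.norm_eq_abs, Nat.abs_cast]
  rw [mul_pow, div_mul_eq_mul_div]
  gcongr
  exact le_mul_of_one_le_right h2.le h1

lemma hasDerivAt_besselSeries (s : ℝ) (k : ℕ) (z : ℝ) :
    HasDerivAt (besselSeries s k) (s * besselSeries s (k + 1) z) z := by
  have key : HasDerivAt (besselSeries s k)
      (∑' m : ℕ, s ^ m / ((m.factorial : ℝ) * ((m + k).factorial : ℝ)) * (m * z ^ (m - 1))) z := by
    have hsum : Summable fun m : ℕ => |s| * (|s| * (|z| + 1)) ^ (m - 1) / ((m - 1).factorial : ℝ) := by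
      rw [← summable_nat_add_iff 1]
      simp only [Nat.add_sub_cancel, mul_div_assoc]
      exact (Real.summable_pow_div_factorial _).mul_left _
    have hz : z ∈ Metric.ball (0 : ℝ) (|z| + 1) := by
      rw [mem_ball_zero_iff, Real.norm_eq_abs]; linarith
    refine hasDerivAt_tsum_of_isPreconnected
      (g := fun (m : ℕ) (y : ℝ) => s ^ m / ((m.factorial : ℝ) * ((m + k).factorial : ℝ)) * y ^ m)
      (g' := fun (m : ℕ) (y : ℝ) =>
        s ^ m / ((m.factorial : ℝ) * ((m + k).factorial : ℝ)) * (m * y ^ (m - 1)))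
      hsum Metric.isOpen_ball (convex_ball _ _).isPreconnected (fun m y _ => ?_)
      (fun m y hy => ?_) hz (summable_besselSeries s k z) hz
    · exact (hasDerivAt_pow m y).const_mul _
    · rcases m with _ | m
      · simp
      · have h1 : (1 : ℝ) ≤ ((m + 1 + k).factorial : ℝ) := by
          exact_mod_cast Nat.one_le_iff_ne_zero.2 (Nat.factorial_ne_zero _)
        have h2 : (0 : ℝ) < (m.factorial : ℝ) := by exact_mod_cast Nat.factorial_pos m
        have h3 : |y| ≤ |z| + 1 := by
          have := mem_ball_zero_iff.1 hy
          exact this.le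
        have h4 : (0 : ℝ) < m + 1 := by positivity
        simp only [norm_mul, norm_div, norm_pow, Real.norm_eq_abs, Nat.abs_cast]
        rw [Nat.add_sub_cancel, Nat.factorial_succ]
        have : |s| ^ (m + 1) / (((m + 1) * m.factorial : ℕ) * ((m + 1 + k).factorial : ℝ)) *
            (((m + 1 : ℕ) : ℝ) * |y| ^ m) =
            |s| * (|s| * |y|) ^ m / (m.factorial * ((m + 1 + k).factorial : ℝ)) := by
          push_cast; rw [mul_pow]; field_simp; ring
        rw [this]
        gcongr
        exact le_mul_of_one_le_right h2.le h1
  convert key using 1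
  rw [tsum_eq_zero_add']
  · simp only [Nat.cast_zero, zero_mul, mul_zero, zero_add, besselSeries, ← tsum_mul_left]
    refine tsum_congr fun m => ?_
    have h4 : (0 : ℝ) < m + 1 := by positivity
    rw [Nat.factorial_succ m, show m + (k + 1) = m + 1 + k by ring]
    push_cast
    field_simp
    ring
  · refine ((summable_besselSeries s (k + 1) z).mul_left s).congr fun m => ?_
    have h4 : (0 : ℝ) < m + 1 := by positivity
    rw [Nat.factorial_succ m, show m + (k + 1) = m + 1 + k by ring]
    push_cast
    field_simp
    ring

lemma besselSeries_recurrence (s : ℝ) (k : ℕ) (z : ℝ) :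
    (k + 1) * besselSeries s (k + 1) z + s * z * besselSeries s (k + 2) z = besselSeries s k z := by
  have h0 := summable_besselSeries s k z
  have h1 := summable_besselSeries s (k + 1) z
  have h2 := summable_besselSeries s (k + 2) z
  have e0 : besselSeries s k z = _ := h0.tsum_eq_zero_add
  have e1 : besselSeries s (k + 1) z = _ := h1.tsum_eq_zero_add
  have hk : (0 : ℝ) < k + 1 := by positivity
  have hf : (0 : ℝ) < (k.factorial : ℝ) := by exact_mod_cast Nat.factorial_pos k
  rw [e0, e1, mul_add, add_assoc]
  congr 1
  · simp [Nat.factorial_succ]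
    field_simp
  · rw [besselSeries, ← tsum_mul_left, ← tsum_mul_left, ← Summable.tsum_add]
    · refine tsum_congr fun m => ?_
      rw [show m + 1 + k = m + k + 1 by ring, show m + 1 + (k + 1) = m + k + 1 + 1 by ring,
        show m + (k + 2) = m + k + 1 + 1 by ring, Nat.factorial_succ (m + k + 1),
        Nat.factorial_succ m]
      have h3 : (0 : ℝ) < ((m + k + 1).factorial : ℝ) := by exact_mod_cast Nat.factorial_pos _
      have h4 : (0 : ℝ) < (m.factorial : ℝ) := by exact_mod_cast Nat.factorial_pos _
      push_cast
      have h5 : (0 : ℝ) < (m : ℝ) + k + 1 + 1 := by positivity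
      have h6 : (0 : ℝ) < (m : ℝ) + 1 := by positivity
      field_simp
      ring
    · exact ((summable_nat_add_iff 1).2 h1).mul_left _
    · exact h2.mul_left _

lemma besselSeries_zero (s : ℝ) (k : ℕ) : besselSeries s k 0 = 1 / (k.factorial : ℝ) := by
  rw [besselSeries, tsum_eq_single 0]
  · simp
  · intro m hm; simp [hm]

lemma besselSeries_one_pos (k : ℕ) {z : ℝ} (hz : 0 ≤ z) : 0 < besselSeries 1 k z := by
  refine (summable_besselSeries 1 k z).tsum_pos (fun m => by positivity) 0 ?_
  simp only [pow_zero, mul_one]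
  positivity

/-- `x ↦ ∑ sᵐ (x/2)²ᵐ / (m! (m+k)!)`: for `s = ∓1` this is `J_k`, resp. `I_k`, divided by
`(x/2)ᵏ`. -/
noncomputable def besselNorm (s : ℝ) (k : ℕ) (x : ℝ) : ℝ := besselSeries s k (x ^ 2 / 4)

/-- The derivative of `besselNorm`. -/
noncomputable def besselNormD (s : ℝ) (k : ℕ) (x : ℝ) : ℝ := s * (x / 2) * besselNorm s (k + 1) x

lemma hasDerivAt_besselNorm (s : ℝ) (k : ℕ) (x : ℝ) :
    HasDerivAt (besselNorm s k) (besselNormD s k x) x := by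
  have h : HasDerivAt (fun y : ℝ => y ^ 2 / 4) (x / 2) x := by
    refine ((hasDerivAt_pow 2 x).div_const 4).congr_deriv ?_
    norm_num; ring
  refine ((hasDerivAt_besselSeries s k (x ^ 2 / 4)).comp x h).congr_deriv ?_
  rw [besselNormD, besselNorm]; ring

lemma hasDerivAt_besselNormD (s : ℝ) (k : ℕ) {x : ℝ} (hx : x ≠ 0) :
    HasDerivAt (besselNormD s k)
      (s * besselNorm s k x - (2 * k + 1) / x * besselNormD s k x) x := by
  have h := (((hasDerivAt_id x).div_const 2).const_mul s).mul (hasDerivAt_besselNorm s (k + 1) x)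
  have hr := besselSeries_recurrence s k (x ^ 2 / 4)
  have e : besselNorm s k x = (k + 1) * besselNorm s (k + 1) x +
      s * (x ^ 2 / 4) * besselNorm s (k + 2) x := hr.symm
  refine h.congr_deriv ?_
  rw [e]
  simp only [besselNormD, id]
  field_simp
  ring

lemma continuous_besselNorm (s : ℝ) (k : ℕ) : Continuous (besselNorm s k) :=
  continuous_iff_continuousAt.2 fun x => (hasDerivAt_besselNorm s k x).continuousAt

lemma continuous_besselNormD (s : ℝ) (k : ℕ) : Continuous (besselNormD s k) := by
  unfold besselNormD
  have := continuous_besselNorm s (k + 1)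
  fun_prop

lemma besselNorm_zero_pos (s : ℝ) (k : ℕ) : 0 < besselNorm s k 0 := by
  rw [besselNorm]
  norm_num
  rw [besselSeries_zero]
  positivity

lemma besselNormD_zero (s : ℝ) (k : ℕ) : besselNormD s k 0 = 0 := by simp [besselNormD]

lemma besselNorm_one_pos (k : ℕ) (x : ℝ) : 0 < besselNorm 1 k x :=
  besselSeries_one_pos k (by positivity)

lemma besselNormD_one_nonneg (k : ℕ) {x : ℝ} (hx : 0 ≤ x) : 0 ≤ besselNormD 1 k x := by
  have := besselNorm_one_pos (k + 1) x
  unfold besselNormD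
  positivity

lemma besselJ_eq (k : ℕ) (x : ℝ) : besselJ k x = (x / 2) ^ k * besselNorm (-1) k x := by
  rw [besselJ, besselNorm, besselSeries, ← tsum_mul_left]
  refine tsum_congr fun m => ?_
  rw [show x ^ 2 / 4 = (x / 2) ^ 2 by ring, ← pow_mul, pow_add]
  ring

lemma besselI_eq (k : ℕ) (x : ℝ) : besselI k x = (x / 2) ^ k * besselNorm 1 k x := by
  rw [besselI, besselNorm, besselSeries, ← tsum_mul_left]
  refine tsum_congr fun m => ?_
  rw [show x ^ 2 / 4 = (x / 2) ^ 2 by ring, ← pow_mul, pow_add, one_pow]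
  ring

lemma hasDerivAt_pow_mul_besselNorm (s : ℝ) (k : ℕ) {x : ℝ} (hx : x ≠ 0) :
    HasDerivAt (fun x => (x / 2) ^ k * besselNorm s k x)
      ((x / 2) ^ k * (k / x * besselNorm s k x + besselNormD s k x)) x := by
  have h := (((hasDerivAt_id x).div_const 2).pow k).mul (hasDerivAt_besselNorm s k x)
  refine h.congr_deriv ?_
  rcases k with _ | k
  · simp
  · simp only [id, Nat.add_sub_cancel, Pi.pow_apply, pow_succ]
    push_cast
    field_simp

lemma deriv_besselJ (k : ℕ) {x : ℝ} (hx : x ≠ 0) : deriv (besselJ k) x =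
    (x / 2) ^ k * (k / x * besselNorm (-1) k x + besselNormD (-1) k x) := by
  rw [show besselJ k = _ from funext (besselJ_eq k)]
  exact (hasDerivAt_pow_mul_besselNorm (-1) k hx).deriv

lemma deriv_besselI (k : ℕ) {x : ℝ} (hx : x ≠ 0) : deriv (besselI k) x =
    (x / 2) ^ k * (k / x * besselNorm 1 k x + besselNormD 1 k x) := by
  rw [show besselI k = _ from funext (besselI_eq k)]
  exact (hasDerivAt_pow_mul_besselNorm 1 k hx).deriv

lemma pos_of_ne_zero_of_pos {f : ℝ → ℝ} {s : Set ℝ} (hs : OrdConnected s) (hf : ContinuousOn f s)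
    (h0 : ∀ x ∈ s, f x ≠ 0) {c : ℝ} (hc : c ∈ s) (hpos : 0 < f c) : ∀ x ∈ s, 0 < f x := by
  intro x hx
  by_contra! h
  obtain ⟨y, hy, hy0⟩ := hs.isPreconnected.intermediate_value hx hc hf ⟨h, hpos.le⟩
  exact h0 y hy hy0

lemma eventually_pos_right {f : ℝ → ℝ} {f' a : ℝ} (hf : HasDerivAt f f' a) (h0 : f a = 0)
    (hpos : 0 < f') : ∀ᶠ x in 𝓝[>] a, 0 < f x := by
  have h := eventually_nhdsWithin_sign_eq_of_deriv_pos (by rwa [hf.deriv]) h0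
  filter_upwards [nhdsWithin_le_nhds h, self_mem_nhdsWithin] with x hx hxa
  rw [sign_pos (sub_pos.2 hxa)] at hx
  exact sign_eq_one_iff.1 hx

lemma eventually_neg_left {f : ℝ → ℝ} {f' a : ℝ} (hf : HasDerivAt f f' a) (h0 : f a = 0)
    (hpos : 0 < f') : ∀ᶠ x in 𝓝[<] a, f x < 0 := by
  have h := eventually_nhdsWithin_sign_eq_of_deriv_pos (by rwa [hf.deriv]) h0
  filter_upwards [nhdsWithin_le_nhds h, self_mem_nhdsWithin] with x hx hxa
  rw [sign_neg (sub_neg.2 hxa)] at hx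
  exact sign_eq_neg_one_iff.1 hx

/-- A function whose derivative is positive at all its zeros has at most one zero. -/
lemma eq_of_zeros_of_deriv_pos {f f' : ℝ → ℝ} {s : Set ℝ} (hs : OrdConnected s)
    (hf : ∀ x ∈ s, HasDerivAt f (f' x) x) (hpos : ∀ x ∈ s, f x = 0 → 0 < f' x)
    {a b : ℝ} (ha : a ∈ s) (hb : b ∈ s) (fa : f a = 0) (fb : f b = 0) : a = b := by
  wlog hab : a < b generalizing a b
  · rcases eq_or_lt_of_le (not_lt.1 hab) with h | h
    · exact h.symm
    · exact (this hb ha fb fa h).symm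
  exfalso
  have hsub : Icc a b ⊆ s := hs.out ha hb
  have hle : ∀ ⦃x⦄, x ∈ Icc a b → (fun x => -f x) x ≤ (fun _ => (0 : ℝ)) x :=
    image_le_of_deriv_right_lt_deriv_boundary (f' := fun x => -f' x) (B' := fun _ => 0)
      (fun x hx => (hf x (hsub hx)).continuousAt.continuousWithinAt.neg)
      (fun x hx => (hf x (hsub (Ico_subset_Icc_self hx))).neg.hasDerivWithinAt)
      (by simp [fa]) (fun x => hasDerivAt_const x 0)
      (fun x hx h => by
        have := hpos x (hsub (Ico_subset_Icc_self hx)) (by simpa using h)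
        simpa using this)
  have h1 := eventually_neg_left (hf b hb) fb (hpos b hb fb)
  have h2 : ∀ᶠ x in 𝓝[<] b, x ∈ Ioo a b := Ioo_mem_nhdsLT hab
  obtain ⟨x, hx1, hx2⟩ := (h1.and h2).exists
  have := hle (Ioo_subset_Icc_self hx2)
  simp only at this
  linarith

lemma exists_mem_Ioc_of_strictMono {r : ℕ → ℝ} {n : ℕ} {x : ℝ} (h0 : r 0 < x) (hn : x ≤ r n) :
    ∃ m < n, x ∈ Ioc (r m) (r (m + 1)) := by
  induction n with
  | zero => exact absurd (h0.trans_le hn) (lt_irrefl _)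
  | succ n ih =>
    rcases le_or_gt x (r n) with h | h
    · obtain ⟨m, hm, hx⟩ := ih h
      exact ⟨m, hm.trans n.lt_succ_self, hx⟩
    · exact ⟨n, n.lt_succ_self, h, hn⟩

/-- A set that meets each of `n` consecutive intervals exactly once, and nothing else, has `n`
elements. -/
lemma encard_eq_of_existsUnique {r : ℕ → ℝ} (hr : StrictMono r) {Z : Set ℝ} {n : ℕ}
    (hZ : ∀ x ∈ Z, ∃ m < n, x ∈ Ioo (r m) (r (m + 1)))
    (h : ∀ m < n, ∃! x, x ∈ Ioo (r m) (r (m + 1)) ∧ x ∈ Z) : Z.encard = n := by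
  choose! z hz hzu using fun m (hm : m < n) => h m hm
  have hinj : InjOn z (Iio n) := by
    intro a ha b hb hab
    by_contra hne
    wlog hlt : a < b generalizing a b
    · exact this hb ha hab.symm (Ne.symm hne) (lt_of_le_of_ne (not_lt.1 hlt) (Ne.symm hne))
    have h1 := (hz a ha).1.2
    have h2 := (hz b hb).1.1
    have h3 := hr.monotone (Nat.succ_le_of_lt hlt)
    rw [hab] at h1
    exact absurd (h2.trans h1) (not_lt.2 h3)
  have himg : Z = z '' Iio n := by
    ext x
    constructor
    · intro hx
      obtain ⟨m, hm, hxm⟩ := hZ x hx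
      exact ⟨m, hm, (hzu m hm x ⟨hxm, hx⟩).symm⟩
    · rintro ⟨m, hm, rfl⟩
      exact (hz m hm).2
  rw [himg, hinj.encard_image]
  simp [← Finset.coe_Iio, Set.encard_coe_eq_coe_finsetCard]

lemma IsNthPositiveRoot.unique {f : ℝ → ℝ} {n : ℕ} {x y : ℝ} (hx : IsNthPositiveRoot f n x)
    (hy : IsNthPositiveRoot f n y) : x = y := by
  wlog hlt : x < y generalizing x y
  · rcases eq_or_lt_of_le (not_lt.1 hlt) with h | h
    · exact h.symm
    · exact (this hy hx h).symm
  exfalso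
  have hsub : insert x {z : ℝ | 0 < z ∧ z < x ∧ f z = 0} ⊆ {z : ℝ | 0 < z ∧ z < y ∧ f z = 0} := by
    intro z hz
    rcases hz with rfl | hz
    · exact ⟨hx.1, hlt, hx.2.1⟩
    · exact ⟨hz.1, hz.2.1.trans hlt, hz.2.2⟩
  have hcard := encard_le_encard hsub
  rw [encard_insert_of_notMem (by simp), hx.2.2] at hcard
  have hy' := hy.2.2
  have : (n : ℕ∞) + 1 ≤ n := by
    calc (n : ℕ∞) + 1 ≤ _ + 1 := by gcongr
      _ = n := hy'
  exact absurd this (by exact_mod_cast (Nat.lt_succ_self n).not_ge)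

lemma alphaRoot_eq {κ : ℝ} {k ℓ : ℕ} {x : ℝ} (hx : IsNthPositiveRoot (bucklingF κ k) ℓ x) :
    alphaRoot κ k ℓ = x := by
  have : {y : ℝ | IsNthPositiveRoot (bucklingF κ k) ℓ y} = {x} := by
    ext y
    exact ⟨fun hy => hy.unique hx, fun hy => by rw [mem_singleton_iff.1 hy]; exact hx⟩
  rw [alphaRoot, this, csInf_singleton]

lemma besselNormD_neg_ne_zero_of_eq_zero (k : ℕ) {a : ℝ} (ha : 0 < a)
    (h0 : besselNorm (-1) k a = 0) : besselNormD (-1) k a ≠ 0 := by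
  intro h1
  set u := besselNorm (-1) k with hu
  set u' := besselNormD (-1) k with hu'
  have hcu : Continuous u := continuous_besselNorm _ _
  have hcu' : Continuous u' := continuous_besselNormD _ _
  have hM : ∀ x ∈ interior (Icc 0 a), HasDerivWithinAt
      (fun x => x ^ (4 * k + 2) * (u x ^ 2 + u' x ^ 2))
      ((4 * k + 2) * x ^ (4 * k + 1) * u x ^ 2) (interior (Icc 0 a)) x := by
    intro x hx
    rw [interior_Icc] at hx
    have hx0 : x ≠ 0 := hx.1.ne'
    refine (((hasDerivAt_pow (4 * k + 2) x).mul
      (((hasDerivAt_besselNorm (-1) k x).pow 2).add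
        ((hasDerivAt_besselNormD (-1) k hx0).pow 2))).congr_deriv ?_).hasDerivWithinAt
    simp only [Pi.add_apply, Pi.pow_apply, ← hu, ← hu',
      show 4 * k + 2 - 1 = 4 * k + 1 from rfl]
    push_cast
    rw [pow_succ x (4 * k + 1)]
    field_simp
    ring
  have hmono := monotoneOn_of_hasDerivWithinAt_nonneg (convex_Icc 0 a)
    (by fun_prop) hM (fun x hx => by
      rw [interior_Icc] at hx
      have := hx.1.le
      positivity)
  have hz : ∀ x ∈ Ioo 0 a, u x = 0 := by
    intro x hx
    have h := hmono (Ioo_subset_Icc_self hx) (right_mem_Icc.2 ha.le) hx.2.le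
    simp only [h0, h1] at h
    have hxp : 0 < x ^ (4 * k + 2) := pow_pos hx.1 _
    have : u x ^ 2 + u' x ^ 2 ≤ 0 := by
      by_contra! hcon
      have := mul_pos hxp hcon
      simp at h
      linarith
    nlinarith [sq_nonneg (u x), sq_nonneg (u' x)]
  have h2 : ∀ᶠ x in 𝓝[>] (0 : ℝ), u x = 0 := by
    filter_upwards [Ioo_mem_nhdsGT ha] with x hx using hz x hx
  have h3 : ∀ᶠ x in 𝓝[>] (0 : ℝ), 0 < u x :=
    nhdsWithin_le_nhds (hcu.continuousAt.eventually_const_lt (besselNorm_zero_pos (-1) k))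
  obtain ⟨x, hx, hx'⟩ := (h2.and h3).exists
  linarith

/-- Sturm comparison with `sin (x / 2)`. -/
lemma exists_besselNorm_neg_zero_gt (k : ℕ) (A : ℝ) : ∃ x > A, besselNorm (-1) k x = 0 := by
  by_contra! hne
  set u := besselNorm (-1) k with hu
  set u' := besselNormD (-1) k with hu'
  set K : ℝ := 2 * k + 1 with hK
  set a : ℝ := max A 0 + K + 1 with ha
  have hK1 : 1 ≤ K := by rw [hK]; linarith [(Nat.cast_nonneg k : (0 : ℝ) ≤ k)]
  have haA : A < a := by rw [ha]; linarith [le_max_left A 0]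
  have haK : K + 1 ≤ a := by rw [ha]; linarith [le_max_right A 0]
  have ha0 : 0 < a := by linarith
  set b : ℝ := a + 2 * Real.pi with hb
  have hpi := Real.pi_pos
  have hcu : Continuous u := continuous_besselNorm _ _
  have hcu' : Continuous u' := continuous_besselNormD _ _
  obtain ⟨σ, hσ⟩ : ∃ σ : ℝ, ∀ x ∈ Icc a b, 0 < σ * u x := by
    have hza : u a ≠ 0 := hne a haA
    refine ⟨u a, pos_of_ne_zero_of_pos ordConnected_Icc (by fun_prop) (fun x hx => ?_)
      (c := a) ⟨le_rfl, by linarith⟩ (mul_self_pos.2 hza)⟩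
    exact mul_ne_zero hza (hne x (haA.trans_le hx.1))
  set T : ℝ → ℝ := fun x => σ * (x ^ (K / 2) * (u x * (1 / 2 * Real.cos ((x - a) / 2)) -
    (u' x + K / (2 * x) * u x) * Real.sin ((x - a) / 2))) with hT
  have hTd : ∀ x ∈ Icc a b, HasDerivAt T (x ^ (K / 2) * ((σ * u x) * Real.sin ((x - a) / 2) *
      (3 / 4 + (2 * K - K ^ 2) / (4 * x ^ 2)))) x := by
    intro x hx
    have hx0 : 0 < x := ha0.trans_le hx.1
    have hsub : HasDerivAt (fun x : ℝ => (x - a) / 2) (1 / 2) x :=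
      ((hasDerivAt_id x).sub_const a).div_const 2
    have hs := hsub.sin
    have hc := (hsub.cos).const_mul (1 / 2)
    have hg := Real.hasDerivAt_rpow_const (x := x) (p := K / 2) (Or.inl hx0.ne')
    rw [Real.rpow_sub_one hx0.ne'] at hg
    have hq : HasDerivAt (fun x : ℝ => K / (2 * x)) (-K / (2 * x ^ 2)) x := by
      refine ((hasDerivAt_const x K).div ((hasDerivAt_id x).const_mul 2) (by simpa using hx0.ne')).congr_deriv ?_
      simp only [id]
      field_simp
      ring
    have hu1 := hasDerivAt_besselNorm (-1) k x
    have hu2 := hasDerivAt_besselNormD (-1) k hx0.ne'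
    refine ((hg.mul ((hu1.mul hc).sub ((hu2.add (hq.mul hu1)).mul hs))).const_mul σ).congr_deriv ?_
    simp only [Pi.mul_apply, Pi.add_apply, Pi.sub_apply, ← hu, ← hu', ← hK]
    field_simp
    ring
  have hmono : MonotoneOn T (Icc a b) := by
    refine monotoneOn_of_hasDerivWithinAt_nonneg (convex_Icc a b)
      (fun x hx => (hTd x hx).continuousAt.continuousWithinAt)
      (fun x hx => (hTd x (interior_subset hx)).hasDerivWithinAt) fun x hx => ?_
    have hx' := interior_subset hx
    have hx0 : 0 < x := ha0.trans_le hx'.1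
    have h1 := hσ x hx'
    have h2 : 0 ≤ Real.sin ((x - a) / 2) :=
      Real.sin_nonneg_of_nonneg_of_le_pi (by linarith [hx'.1]) (by linarith [hx'.2])
    have h3 : 0 ≤ 3 / 4 + (2 * K - K ^ 2) / (4 * x ^ 2) := by
      have : K ≤ x := by linarith [hx'.1]
      have e : 3 / 4 + (2 * K - K ^ 2) / (4 * x ^ 2) = (3 * x ^ 2 + (2 * K - K ^ 2)) / (4 * x ^ 2) := by
        field_simp
      rw [e]
      apply div_nonneg _ (by positivity)
      nlinarith
    positivity
  have hab := hmono (left_mem_Icc.2 (by linarith)) (right_mem_Icc.2 (by linarith : a ≤ b)) (by linarith)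
  have e1 : (b - a) / 2 = Real.pi := by rw [hb]; ring
  simp only [hT, e1, sub_self, zero_div, Real.cos_zero, Real.sin_zero, Real.cos_pi, Real.sin_pi] at hab
  have p1 := mul_pos (Real.rpow_pos_of_pos ha0 (K / 2)) (hσ a ⟨le_rfl, by linarith⟩)
  have p2 := mul_pos (Real.rpow_pos_of_pos (by linarith : 0 < b) (K / 2)) (hσ b ⟨by linarith, le_rfl⟩)
  linarith

lemma eventually_besselNorm_neg_ne_zero (k : ℕ) {a : ℝ} (ha : 0 < a) :
    ∀ᶠ x in 𝓝[≠] a, besselNorm (-1) k x ≠ 0 := by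
  by_cases h : besselNorm (-1) k a = 0
  · exact (hasDerivAt_besselNorm (-1) k a).eventually_ne
      (besselNormD_neg_ne_zero_of_eq_zero k ha h)
  · exact nhdsWithin_le_nhds ((continuous_besselNorm (-1) k).continuousAt.eventually_ne h)

lemma exists_next_besselNorm_neg_zero (k : ℕ) {a : ℝ} (ha : 0 ≤ a) :
    ∃ b > a, besselNorm (-1) k b = 0 ∧ ∀ x ∈ Ioo a b, besselNorm (-1) k x ≠ 0 := by
  have hev : ∀ᶠ x in 𝓝[>] a, besselNorm (-1) k x ≠ 0 := by
    rcases ha.eq_or_lt with rfl | ha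
    · exact nhdsWithin_le_nhds ((continuous_besselNorm (-1) k).continuousAt.eventually_ne
        (besselNorm_zero_pos (-1) k).ne')
    · exact nhdsGT_le_nhdsNE a (eventually_besselNorm_neg_ne_zero k ha)
  obtain ⟨c, hac, hc⟩ := mem_nhdsGT_iff_exists_Ioo_subset.1 hev
  obtain ⟨z, hz, hz0⟩ := exists_besselNorm_neg_zero_gt k a
  set Z := Ici c ∩ {x | besselNorm (-1) k x = 0} with hZ
  have hZc : IsClosed Z :=
    isClosed_Ici.inter (isClosed_eq (continuous_besselNorm _ _) continuous_const)
  have hmem : ∀ x, a < x → besselNorm (-1) k x = 0 → x ∈ Z := by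
    intro x hx h0
    refine ⟨?_, h0⟩
    by_contra hcon
    exact hc ⟨hx, not_le.1 hcon⟩ h0
  have hbdd : BddBelow Z := ⟨c, fun x hx => hx.1⟩
  have hs := hZc.csInf_mem ⟨z, hmem z hz hz0⟩ hbdd
  refine ⟨sInf Z, hac.trans_le hs.1, hs.2, fun x hx h0 => ?_⟩
  exact absurd (csInf_le hbdd (hmem x hx.1 h0)) (not_le.2 hx.2)

/-- The increasing sequence `j` of the positive zeros of `J_k`, preceded by `j 0 = 0`, with the
sign pattern of `J_k`. -/
structure IsZeroSeq (k : ℕ) (j : ℕ → ℝ) : Prop where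
  zero : j 0 = 0
  strictMono : StrictMono j
  eq_zero : ∀ m, besselNorm (-1) k (j (m + 1)) = 0
  pos : ∀ m, ∀ x ∈ Ioo (j m) (j (m + 1)), 0 < (-1) ^ m * besselNorm (-1) k x
  deriv_neg : ∀ m, 0 < (-1) ^ (m + 1) * besselNormD (-1) k (j (m + 1))
  exists_gt : ∀ x, ∃ m, x < j m

lemma exists_isZeroSeq (k : ℕ) : ∃ j, IsZeroSeq k j := by
  choose! next hgt hzero hne using fun (a : ℝ) (ha : 0 ≤ a) => exists_next_besselNorm_neg_zero k ha
  set j : ℕ → ℝ := fun n => next^[n] 0 with hj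
  have hsucc : ∀ n, j (n + 1) = next (j n) := fun n => Function.iterate_succ_apply' _ _ _
  have h0 : j 0 = 0 := rfl
  have hnn : ∀ n, 0 ≤ j n := by
    intro n
    induction n with
    | zero => exact le_rfl
    | succ n ih => rw [hsucc]; exact ih.trans (hgt _ ih).le
  have hmono : StrictMono j := strictMono_nat_of_lt_succ fun n => by
    rw [hsucc]; exact hgt _ (hnn n)
  have hpos : ∀ n, 0 < j (n + 1) := fun n => h0 ▸ hmono n.succ_pos
  have hz : ∀ m, besselNorm (-1) k (j (m + 1)) = 0 := fun m => by
    rw [hsucc]; exact hzero _ (hnn m)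
  have hd : ∀ m, besselNormD (-1) k (j (m + 1)) ≠ 0 := fun m =>
    besselNormD_neg_ne_zero_of_eq_zero k (hpos m) (hz m)
  have hcont : Continuous (besselNorm (-1) k) := continuous_besselNorm _ _
  have hne' : ∀ m, ∀ x ∈ Ioo (j m) (j (m + 1)), besselNorm (-1) k x ≠ 0 := fun m x hx => by
    rw [hsucc] at hx; exact hne _ (hnn m) x hx
  have hder : ∀ m, ∀ σ : ℝ, σ ≠ 0 →
      (∀ x ∈ Ioo (j m) (j (m + 1)), 0 < σ * besselNorm (-1) k x) →
      0 < -σ * besselNormD (-1) k (j (m + 1)) := by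
    intro m σ hσ hp
    by_contra! h
    have h1 : 0 < σ * besselNormD (-1) k (j (m + 1)) :=
      lt_of_le_of_ne (by linarith) (mul_ne_zero hσ (hd m)).symm
    have h2 := eventually_neg_left ((hasDerivAt_besselNorm (-1) k (j (m + 1))).const_mul σ)
      (by simp [hz m]) h1
    obtain ⟨x, hx, hx'⟩ := (h2.and (Ioo_mem_nhdsLT (hmono m.lt_succ_self))).exists
    exact absurd (hp x hx') (not_lt.2 hx.le)
  have hsign : ∀ m, ∀ x ∈ Ioo (j m) (j (m + 1)), 0 < (-1) ^ m * besselNorm (-1) k x := by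
    intro m
    have hev : ∀ᶠ x in 𝓝[>] (j m), 0 < (-1) ^ m * besselNorm (-1) k x := by
      induction m with
      | zero =>
        refine nhdsWithin_le_nhds ((hcont.const_mul ((-1) ^ 0)).continuousAt.eventually_const_lt ?_)
        simpa [h0] using besselNorm_zero_pos (-1) k
      | succ m ih =>
        obtain ⟨c, hc, hc'⟩ := (ih.and (Ioo_mem_nhdsGT (hmono m.lt_succ_self))).exists
        have hp := pos_of_ne_zero_of_pos ordConnected_Ioo (hcont.const_mul ((-1) ^ m)).continuousOn
          (fun x hx => mul_ne_zero (by simp) (hne' m x hx)) hc' hc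
        have := hder m ((-1) ^ m) (by simp) hp
        exact eventually_pos_right ((hasDerivAt_besselNorm (-1) k (j (m + 1))).const_mul _)
          (by simp [hz m]) (by rw [pow_succ]; linarith)
    obtain ⟨c, hc, hc'⟩ := (hev.and (Ioo_mem_nhdsGT (hmono m.lt_succ_self))).exists
    exact pos_of_ne_zero_of_pos ordConnected_Ioo (hcont.const_mul ((-1) ^ m)).continuousOn
      (fun x hx => mul_ne_zero (by simp) (hne' m x hx)) hc' hc
  refine ⟨j, h0, hmono, hz, hsign, fun m => ?_, fun x => ?_⟩
  · have := hder m ((-1) ^ m) (by simp) (hsign m)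
    rw [pow_succ]; linarith
  · by_contra! hcon
    have hb : BddAbove (range j) := ⟨x, by rintro _ ⟨m, rfl⟩; exact hcon m⟩
    have hlim := tendsto_atTop_ciSup hmono.monotone hb
    have hlt : ∀ n, j n < ⨆ i, j i := fun n => (hmono n.lt_succ_self).trans_le (le_ciSup hb _)
    have hlim' : Tendsto j atTop (𝓝[≠] (⨆ i, j i)) :=
      tendsto_nhdsWithin_iff.2 ⟨hlim, Eventually.of_forall fun n => (hlt n).ne⟩
    have h := hlim'.eventually (eventually_besselNorm_neg_ne_zero k ((hpos 0).trans (hlt 1)))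
    obtain ⟨n, hn, hn1⟩ := (h.and (eventually_ge_atTop 1)).exists
    obtain ⟨m, rfl⟩ : ∃ m, n = m + 1 := ⟨n - 1, by omega⟩
    exact hn (hz m)

lemma IsZeroSeq.pos_succ {k : ℕ} {j : ℕ → ℝ} (hj : IsZeroSeq k j) (m : ℕ) : 0 < j (m + 1) :=
  hj.zero ▸ hj.strictMono m.succ_pos

/-- The increasing sequence `r` of the positive zeros of `f`, preceded by `r 0 = 0`; its `m`-th
term lies between the `m`-th and the `m+1`-st term of `j`. -/
structure IsInterlacedZeroSeq (j : ℕ → ℝ) (f : ℝ → ℝ) (r : ℕ → ℝ) : Prop where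
  zero : r 0 = 0
  mem : ∀ m, r (m + 1) ∈ Ioo (j (m + 1)) (j (m + 2))
  eq_zero : ∀ m, f (r (m + 1)) = 0
  exists_eq : ∀ x, 0 < x → f x = 0 → ∃ m, x = r (m + 1)

lemma exists_isInterlacedZeroSeq {k : ℕ} {j : ℕ → ℝ} (hj : IsZeroSeq k j) {f f' : ℝ → ℝ}
    (hf : ∀ x, 0 < x → HasDerivAt f (f' x) x) (hpos : ∀ x ∈ Ioc 0 (j 1), 0 < f x)
    (hsign : ∀ m, 0 < (-1) ^ m * f (j (m + 1)))
    (hder : ∀ x, j 1 < x → f x = 0 → besselNorm (-1) k x ≠ 0 → 0 < besselNorm (-1) k x * f' x) :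
    ∃ r, IsInterlacedZeroSeq j f r := by
  have hex : ∀ m, ∃ x ∈ Ioo (j (m + 1)) (j (m + 2)), f x = 0 := by
    intro m
    have hlt := hj.strictMono (m + 1).lt_succ_self
    have hc : ContinuousOn (fun x => (-1) ^ m * f x) (Icc (j (m + 1)) (j (m + 2))) := fun x hx =>
      ((hf x ((hj.pos_succ m).trans_le hx.1)).continuousAt.const_mul ((-1) ^ m)).continuousWithinAt
    obtain ⟨x, hx, hx0⟩ := intermediate_value_Ioo' hlt.le hc (show (0 : ℝ) ∈ _ from
      ⟨by have := hsign (m + 1); rw [pow_succ] at this; linarith, hsign m⟩)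
    exact ⟨x, hx, by simpa using hx0⟩
  have hun : ∀ m, ∀ x ∈ Ioo (j (m + 1)) (j (m + 2)), ∀ y ∈ Ioo (j (m + 1)) (j (m + 2)),
      f x = 0 → f y = 0 → x = y := by
    intro m x hx y hy fx fy
    have hj0 : ∀ z ∈ Ioo (j (m + 1)) (j (m + 2)), j 1 < z := fun z hz =>
      (hj.strictMono.monotone (by omega)).trans_lt hz.1
    refine eq_of_zeros_of_deriv_pos (f := fun z => (-1) ^ (m + 1) * f z)
      (f' := fun z => (-1) ^ (m + 1) * f' z) ordConnected_Ioo
      (fun z hz => (hf z ((hj.pos_succ 0).trans (hj0 z hz))).const_mul _) (fun z hz h0 => ?_)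
      hx hy (by simp [fx]) (by simp [fy])
    have hu := hj.pos (m + 1) z hz
    have hne : besselNorm (-1) k z ≠ 0 := fun h => by simp [h] at hu
    have hd := hder z (hj0 z hz) (by simpa using h0) hne
    have hsq : ((-1 : ℝ) ^ (m + 1)) * (-1) ^ (m + 1) = 1 := by rw [← mul_pow]; simp
    have : 0 < ((-1) ^ (m + 1) * besselNorm (-1) k z) * ((-1) ^ (m + 1) * f' z) := by
      calc 0 < besselNorm (-1) k z * f' z := hd
        _ = (((-1 : ℝ) ^ (m + 1)) * (-1) ^ (m + 1)) * (besselNorm (-1) k z * f' z) := by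
          rw [hsq, one_mul]
        _ = _ := by ring
    exact (mul_pos_iff_of_pos_left hu).1 this
  choose r hr hr0 using hex
  refine ⟨fun n => Nat.casesOn n 0 r, rfl, hr, hr0, fun x hx hx0 => ?_⟩
  obtain ⟨N, hN⟩ := hj.exists_gt x
  obtain ⟨m, -, hm⟩ := exists_mem_Ioc_of_strictMono (hj.zero.trans_lt hx) hN.le
  rcases m with _ | m
  · rw [hj.zero] at hm
    exact absurd hx0 (hpos x hm).ne'
  · have hne : x ≠ j (m + 1 + 1) := fun h => by
      have := hsign (m + 1)
      rw [← h, hx0] at this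
      simp at this
    exact ⟨m, hun m x ⟨hm.1, lt_of_le_of_ne hm.2 hne⟩ _ (hr m) hx0 (hr0 m)⟩

lemma IsInterlacedZeroSeq.strictMono {k : ℕ} {j r : ℕ → ℝ} {f : ℝ → ℝ} (hj : IsZeroSeq k j)
    (hr : IsInterlacedZeroSeq j f r) : StrictMono r := by
  refine strictMono_nat_of_lt_succ fun n => ?_
  rcases n with _ | n
  · rw [hr.zero]
    exact (hj.pos_succ 0).trans (hr.mem 0).1
  · exact (hr.mem n).2.trans (hr.mem (n + 1)).1

lemma IsInterlacedZeroSeq.isNthPositiveRoot {k : ℕ} {j r : ℕ → ℝ} {f : ℝ → ℝ}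
    (hj : IsZeroSeq k j) (hr : IsInterlacedZeroSeq j f r) (n : ℕ) :
    IsNthPositiveRoot f (n + 1) (r (n + 1)) := by
  have hmono := hr.strictMono hj
  have hp : ∀ m, 0 < r (m + 1) := fun m => hr.zero ▸ hmono m.succ_pos
  refine ⟨hp n, hr.eq_zero n, ?_⟩
  rw [encard_eq_of_existsUnique (r := fun m => j (m + 1)) (n := n)
    (fun a b hab => hj.strictMono (by omega)), Nat.cast_succ]
  · rintro x ⟨hx, hxn, hx0⟩
    obtain ⟨m, rfl⟩ := hr.exists_eq x hx hx0
    exact ⟨m, by have := hmono.lt_iff_lt.1 hxn; omega, hr.mem m⟩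
  · refine fun m hm => ⟨r (m + 1), ⟨hr.mem m, hp m, hmono (by omega), hr.eq_zero m⟩, ?_⟩
    rintro y ⟨hy, hy', -, hy0⟩
    obtain ⟨i, rfl⟩ := hr.exists_eq y hy' hy0
    have h1 := hr.mem i
    have a1 := hj.strictMono.lt_iff_lt.1 (h1.1.trans hy.2)
    have a2 := hj.strictMono.lt_iff_lt.1 (hy.1.trans h1.2)
    rw [show i = m by omega]

/-- The Wronskian of `besselNorm (-1) k` and `x ↦ besselNorm 1 k (τ x)`. -/
noncomputable def besselWr (k : ℕ) (τ x : ℝ) : ℝ :=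
  besselNorm (-1) k x * (τ * besselNormD 1 k (τ * x)) -
    besselNorm 1 k (τ * x) * besselNormD (-1) k x

lemma hasDerivAt_besselNorm_mul (s : ℝ) (k : ℕ) (τ x : ℝ) :
    HasDerivAt (fun x => besselNorm s k (τ * x)) (τ * besselNormD s k (τ * x)) x := by
  have h : HasDerivAt (fun x : ℝ => τ * x) τ x := by
    simpa using (hasDerivAt_id x).const_mul τ
  exact ((hasDerivAt_besselNorm s k (τ * x)).comp x h).congr_deriv (mul_comm _ _)

lemma hasDerivAt_besselNormD_mul (s : ℝ) (k : ℕ) {τ x : ℝ} (hτ : τ ≠ 0) (hx : x ≠ 0) :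
    HasDerivAt (fun x => τ * besselNormD s k (τ * x))
      (s * τ ^ 2 * besselNorm s k (τ * x) - (2 * k + 1) / x * (τ * besselNormD s k (τ * x))) x := by
  have h : HasDerivAt (fun x : ℝ => τ * x) τ x := by
    simpa using (hasDerivAt_id x).const_mul τ
  refine (((hasDerivAt_besselNormD s k (mul_ne_zero hτ hx)).comp x h).const_mul τ).congr_deriv ?_
  field_simp

lemma hasDerivAt_besselWr (k : ℕ) {τ x : ℝ} (hτ : τ ≠ 0) (hx : x ≠ 0) :
    HasDerivAt (besselWr k τ) ((1 + τ ^ 2) * (besselNorm (-1) k x * besselNorm 1 k (τ * x)) -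
      (2 * k + 1) / x * besselWr k τ x) x := by
  refine (((hasDerivAt_besselNorm (-1) k x).mul (hasDerivAt_besselNormD_mul 1 k hτ hx)).sub
    ((hasDerivAt_besselNorm_mul 1 k τ x).mul (hasDerivAt_besselNormD (-1) k hx))).congr_deriv ?_
  rw [besselWr]
  ring

lemma hasDerivAt_pow_mul_besselWr (k : ℕ) {τ x : ℝ} (hτ : τ ≠ 0) (hx : x ≠ 0) :
    HasDerivAt (fun x => x ^ (2 * k + 1) * besselWr k τ x)
      ((1 + τ ^ 2) * x ^ (2 * k + 1) * (besselNorm (-1) k x * besselNorm 1 k (τ * x))) x := by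
  refine ((hasDerivAt_pow (2 * k + 1) x).mul (hasDerivAt_besselWr k hτ hx)).congr_deriv ?_
  rw [Nat.add_sub_cancel, pow_succ]
  push_cast
  field_simp
  ring

lemma continuous_besselNorm_mul (s : ℝ) (k : ℕ) (τ : ℝ) :
    Continuous fun x => besselNorm s k (τ * x) :=
  (continuous_besselNorm s k).comp (continuous_const_mul τ)

lemma continuous_besselNormD_mul (s : ℝ) (k : ℕ) (τ : ℝ) :
    Continuous fun x => besselNormD s k (τ * x) :=
  (continuous_besselNormD s k).comp (continuous_const_mul τ)

lemma continuous_besselWr (k : ℕ) (τ : ℝ) : Continuous (besselWr k τ) := by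
  have h1 := continuous_besselNorm (-1) k
  have h2 := continuous_besselNormD (-1) k
  have h3 := continuous_besselNorm_mul 1 k τ
  have h4 := continuous_besselNormD_mul 1 k τ
  unfold besselWr
  fun_prop

lemma besselWr_zero (k : ℕ) (τ : ℝ) : besselWr k τ 0 = 0 := by
  simp [besselWr, besselNormD_zero]

lemma IsZeroSeq.besselWr_pos {k : ℕ} {j : ℕ → ℝ} (hj : IsZeroSeq k j) {τ : ℝ} (hτ : 0 < τ) :
    ∀ x ∈ Ioc 0 (j 1), 0 < besselWr k τ x := by
  intro x hx
  have hW := continuous_besselWr k τ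
  have hmono : StrictMonoOn (fun x => x ^ (2 * k + 1) * besselWr k τ x) (Icc 0 (j 1)) := by
    refine strictMonoOn_of_hasDerivWithinAt_pos (convex_Icc _ _) (by fun_prop)
      (fun y hy => (hasDerivAt_pow_mul_besselWr k hτ.ne' (x := y) ?_).hasDerivWithinAt) fun y hy => ?_
    · rw [interior_Icc] at hy
      exact hy.1.ne'
    · rw [interior_Icc] at hy
      have h1 := hj.pos 0 y (by rw [hj.zero]; exact hy)
      have h2 := besselNorm_one_pos k (τ * y)
      have h3 := hy.1
      rw [pow_zero, one_mul] at h1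
      positivity
  have h := hmono ⟨le_rfl, (hj.pos_succ 0).le⟩ ⟨hx.1.le, hx.2⟩ hx.1
  simp only [besselWr_zero, mul_zero] at h
  exact (mul_pos_iff_of_pos_left (pow_pos hx.1 _)).1 h

lemma IsZeroSeq.besselWr_sign {k : ℕ} {j : ℕ → ℝ} (hj : IsZeroSeq k j) (τ : ℝ) (m : ℕ) :
    0 < (-1) ^ m * besselWr k τ (j (m + 1)) := by
  have h1 := mul_pos (hj.deriv_neg m) (besselNorm_one_pos k (τ * j (m + 1)))
  rw [pow_succ] at h1
  rw [besselWr, hj.eq_zero]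
  linarith

lemma IsZeroSeq.exists_besselWr_zeroSeq {k : ℕ} {j : ℕ → ℝ} (hj : IsZeroSeq k j) {τ : ℝ}
    (hτ : 0 < τ) : ∃ r, IsInterlacedZeroSeq j (besselWr k τ) r := by
  refine exists_isInterlacedZeroSeq hj (fun x hx => hasDerivAt_besselWr k hτ.ne' hx.ne')
    (hj.besselWr_pos hτ) (hj.besselWr_sign τ) fun x _ h0 hne => ?_
  have h2 := besselNorm_one_pos k (τ * x)
  have h3 : 0 < besselNorm (-1) k x ^ 2 := by positivity
  rw [h0]
  have : 0 < (1 + τ ^ 2) * (besselNorm (-1) k x ^ 2 * besselNorm 1 k (τ * x)) := by positivity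
  linarith

/-- The quotient of `besselNorm (-1) k` and `x ↦ besselNorm 1 k (τ x)`. -/
noncomputable def besselQuot (k : ℕ) (τ x : ℝ) : ℝ := besselNorm (-1) k x / besselNorm 1 k (τ * x)

/-- The energy of the damped oscillator equation satisfied by `besselQuot k τ`. -/
noncomputable def besselQuotEnergy (k : ℕ) (τ x : ℝ) : ℝ :=
  (besselWr k τ x / besselNorm 1 k (τ * x) ^ 2) ^ 2 / (1 + τ ^ 2) + besselQuot k τ x ^ 2

lemma hasDerivAt_besselQuot (k : ℕ) (τ x : ℝ) :
    HasDerivAt (besselQuot k τ) (-besselWr k τ x / besselNorm 1 k (τ * x) ^ 2) x := by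
  refine ((hasDerivAt_besselNorm (-1) k x).div (hasDerivAt_besselNorm_mul 1 k τ x)
    (besselNorm_one_pos k _).ne').congr_deriv ?_
  rw [besselWr]
  ring

lemma continuous_besselQuot (k : ℕ) (τ : ℝ) : Continuous (besselQuot k τ) :=
  continuous_iff_continuousAt.2 fun x => (hasDerivAt_besselQuot k τ x).continuousAt

lemma continuous_besselQuotEnergy (k : ℕ) (τ : ℝ) : Continuous (besselQuotEnergy k τ) := by
  have h1 := continuous_besselWr k τ
  have h2 := continuous_besselNorm_mul 1 k τ
  have h3 := continuous_besselQuot k τ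
  have h4 : ∀ x, besselNorm 1 k (τ * x) ^ 2 ≠ 0 := fun x =>
    pow_ne_zero _ (besselNorm_one_pos k _).ne'
  unfold besselQuotEnergy
  fun_prop (disch := first | assumption | positivity)

lemma hasDerivAt_besselQuotEnergy (k : ℕ) {τ x : ℝ} (hτ : τ ≠ 0) (hx : x ≠ 0) :
    HasDerivAt (besselQuotEnergy k τ) (-(2 * (besselWr k τ x / besselNorm 1 k (τ * x) ^ 2) ^ 2 *
      ((2 * k + 1) / x + 2 * (τ * besselNormD 1 k (τ * x)) / besselNorm 1 k (τ * x)) /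
        (1 + τ ^ 2))) x := by
  have hV : besselNorm 1 k (τ * x) ≠ 0 := (besselNorm_one_pos k _).ne'
  have hω : (1 + τ ^ 2) ≠ 0 := by positivity
  have h : HasDerivAt (fun x => besselWr k τ x / besselNorm 1 k (τ * x) ^ 2)
      ((1 + τ ^ 2) * besselQuot k τ x - ((2 * k + 1) / x +
        2 * (τ * besselNormD 1 k (τ * x)) / besselNorm 1 k (τ * x)) *
          (besselWr k τ x / besselNorm 1 k (τ * x) ^ 2)) x := by
    refine ((hasDerivAt_besselWr k hτ hx).div ((hasDerivAt_besselNorm_mul 1 k τ x).pow 2)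
      (pow_ne_zero 2 hV)).congr_deriv ?_
    simp only [Pi.pow_apply, besselQuot]
    generalize besselNorm 1 k (τ * x) = V at hV ⊢
    field_simp
    ring
  refine (((h.pow 2).div_const (1 + τ ^ 2)).add
    ((hasDerivAt_besselQuot k τ x).pow 2)).congr_deriv ?_
  rw [neg_div]
  generalize besselWr k τ x / besselNorm 1 k (τ * x) ^ 2 = w
  field_simp
  ring

lemma besselQuotEnergy_strictAntiOn (k : ℕ) {τ : ℝ} (hτ : 0 < τ) :
    StrictAntiOn (besselQuotEnergy k τ) (Ici 0) := by
  have hanti : AntitoneOn (besselQuotEnergy k τ) (Ici 0) := by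
    refine antitoneOn_of_hasDerivWithinAt_nonpos (convex_Ici 0)
      (continuous_besselQuotEnergy k τ).continuousOn
      (fun x hx => (hasDerivAt_besselQuotEnergy k hτ.ne' (x := x) ?_).hasDerivWithinAt)
      fun x hx => ?_
    · rw [interior_Ici] at hx
      exact (mem_Ioi.1 hx).ne'
    · rw [interior_Ici, mem_Ioi] at hx
      have h1 := besselNorm_one_pos k (τ * x)
      have h2 := besselNormD_one_nonneg k (mul_nonneg hτ.le hx.le)
      rw [neg_nonpos]
      positivity
  intro x hx y hy hxy
  refine lt_of_le_of_ne (hanti hx hy hxy.le) fun heq => ?_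
  have hx0 : ∀ z ∈ Ioo x y, 0 < z := fun z hz => (mem_Ici.1 hx).trans_lt hz.1
  have hconst : ∀ z ∈ Ioo x y, besselQuotEnergy k τ z = besselQuotEnergy k τ x := fun z hz =>
    le_antisymm (hanti hx (hx0 z hz).le hz.1.le) (heq ▸ hanti (hx0 z hz).le hy hz.2.le)
  have hW : ∀ z ∈ Ioo x y, besselWr k τ z = 0 := by
    intro z hz
    have hz0 := hx0 z hz
    have hloc : besselQuotEnergy k τ =ᶠ[𝓝 z] fun _ => besselQuotEnergy k τ x := by
      filter_upwards [Ioo_mem_nhds hz.1 hz.2] with w hw using hconst w hw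
    have hd := (hasDerivAt_besselQuotEnergy k hτ.ne' hz0.ne').unique
      ((hasDerivAt_const z _).congr_of_eventuallyEq hloc)
    have h1 := besselNorm_one_pos k (τ * z)
    have h2 := besselNormD_one_nonneg k (mul_nonneg hτ.le hz0.le)
    by_contra hne
    have : 0 < 2 * (besselWr k τ z / besselNorm 1 k (τ * z) ^ 2) ^ 2 *
      ((2 * k + 1) / z + 2 * (τ * besselNormD 1 k (τ * z)) / besselNorm 1 k (τ * z)) /
        (1 + τ ^ 2) := by positivity
    linarith
  have hu : ∀ z ∈ Ioo x y, besselNorm (-1) k z = 0 := by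
    intro z hz
    have hloc : besselWr k τ =ᶠ[𝓝 z] fun _ => 0 := by
      filter_upwards [Ioo_mem_nhds hz.1 hz.2] with w hw using hW w hw
    have hd := (hasDerivAt_besselWr k hτ.ne' (hx0 z hz).ne').unique
      ((hasDerivAt_const z _).congr_of_eventuallyEq hloc)
    rw [hW z hz, mul_zero, sub_zero] at hd
    have h1 := (besselNorm_one_pos k (τ * z)).ne'
    have h2 : (1 + τ ^ 2) ≠ 0 := by positivity
    simpa [h1, h2] using hd
  obtain ⟨c, hc⟩ := exists_between hxy
  obtain ⟨z, hz, hz'⟩ := ((eventually_besselNorm_neg_ne_zero k (hx0 c hc)).and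
    (nhdsWithin_le_nhds (Ioo_mem_nhds hc.1 hc.2))).exists
  exact hz (hu z hz')

lemma abs_besselQuot_lt_of_besselWr_eq_zero {k : ℕ} {τ : ℝ} (hτ : 0 < τ) {x y : ℝ} (hx : 0 ≤ x)
    (hxy : x < y) (hWx : besselWr k τ x = 0) (hWy : besselWr k τ y = 0) :
    |besselQuot k τ y| < |besselQuot k τ x| := by
  have h := besselQuotEnergy_strictAntiOn k hτ hx (hx.trans hxy.le) hxy
  simp only [besselQuotEnergy, hWx, hWy] at h
  exact sq_lt_sq.1 (by simpa using h)

section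

variable {k : ℕ} {j r : ℕ → ℝ} {τ : ℝ}

lemma IsInterlacedZeroSeq.besselWr_eq_zero (hr : IsInterlacedZeroSeq j (besselWr k τ) r) (m : ℕ) :
    besselWr k τ (r m) = 0 := by
  rcases m with _ | m
  · rw [hr.zero, besselWr_zero]
  · exact hr.eq_zero m

lemma IsInterlacedZeroSeq.nonneg (hj : IsZeroSeq k j)
    (hr : IsInterlacedZeroSeq j (besselWr k τ) r) (m : ℕ) : 0 ≤ r m :=
  hr.zero ▸ (hr.strictMono hj).monotone m.zero_le

lemma IsInterlacedZeroSeq.abs_besselQuot_lt (hj : IsZeroSeq k j) (hτ : 0 < τ)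
    (hr : IsInterlacedZeroSeq j (besselWr k τ) r) {m n : ℕ} (hmn : m < n) :
    |besselQuot k τ (r n)| < |besselQuot k τ (r m)| :=
  abs_besselQuot_lt_of_besselWr_eq_zero hτ (hr.nonneg hj m) (hr.strictMono hj hmn)
    (hr.besselWr_eq_zero m) (hr.besselWr_eq_zero n)

lemma IsInterlacedZeroSeq.besselQuot_sign (hj : IsZeroSeq k j)
    (hr : IsInterlacedZeroSeq j (besselWr k τ) r) (m : ℕ) :
    0 < (-1) ^ m * besselQuot k τ (r m) := by
  rw [besselQuot, ← mul_div_assoc]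
  refine div_pos ?_ (besselNorm_one_pos k _)
  rcases m with _ | m
  · simpa [hr.zero] using besselNorm_zero_pos (-1) k
  · exact hj.pos (m + 1) _ (hr.mem m)

lemma IsInterlacedZeroSeq.besselQuot_injOn (hj : IsZeroSeq k j)
    (hr : IsInterlacedZeroSeq j (besselWr k τ) r) (m : ℕ) :
    InjOn (besselQuot k τ) (Icc (r m) (r (m + 1))) := by
  intro x hx y hy hxy
  by_contra hne
  wlog hlt : x < y generalizing x y
  · exact this hy hx hxy.symm (Ne.symm hne) (lt_of_le_of_ne (not_lt.1 hlt) (Ne.symm hne))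
  obtain ⟨c, hc, hc0⟩ := exists_hasDerivAt_eq_zero hlt (continuous_besselQuot k τ).continuousOn hxy
    fun z _ => hasDerivAt_besselQuot k τ z
  have hV := (besselNorm_one_pos k (τ * c)).ne'
  have hW : besselWr k τ c = 0 := by simpa [hV] using hc0
  have hmc : r m < c := hx.1.trans_lt hc.1
  have hcm : c < r (m + 1) := hc.2.trans_le hy.2
  obtain ⟨i, rfl⟩ := hr.exists_eq c ((hr.nonneg hj m).trans_lt hmc) hW
  have h1 := (hr.strictMono hj).lt_iff_lt.1 hmc
  have h2 := (hr.strictMono hj).lt_iff_lt.1 hcm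
  omega

lemma IsInterlacedZeroSeq.besselWr_ne_zero (hj : IsZeroSeq k j) (hτ : 0 < τ)
    (hr : IsInterlacedZeroSeq j (besselWr k τ) r) {n : ℕ} {x : ℝ} (hx : x ∈ Ioo 0 (r n))
    (h : besselQuot k τ x = besselQuot k τ (r n)) : besselWr k τ x ≠ 0 := by
  intro hW
  obtain ⟨i, rfl⟩ := hr.exists_eq x hx.1 hW
  have := hr.abs_besselQuot_lt hj hτ ((hr.strictMono hj).lt_iff_lt.1 hx.2)
  rw [h] at this
  exact lt_irrefl _ this

/-- `besselQuot k τ` takes its value at its `n`-th positive critical point exactly `n - 1` times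
before. -/
lemma IsInterlacedZeroSeq.encard_besselQuot_eq (hj : IsZeroSeq k j) (hτ : 0 < τ)
    (hr : IsInterlacedZeroSeq j (besselWr k τ) r) (n : ℕ) :
    {x | x ∈ Ioo 0 (r (n + 1)) ∧ besselQuot k τ x = besselQuot k τ (r (n + 1))}.encard = n := by
  have hmono := hr.strictMono hj
  refine encard_eq_of_existsUnique hmono ?_ ?_
  · rintro x ⟨hx, hxe⟩
    obtain ⟨m, hm, hxm⟩ := exists_mem_Ioc_of_strictMono (hr.zero.trans_lt hx.1) hx.2.le
    have hmn : m ≠ n := by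
      rintro rfl
      exact hx.2.ne (hr.besselQuot_injOn hj m (Ioc_subset_Icc_self hxm)
        (right_mem_Icc.2 (hmono m.lt_succ_self).le) hxe)
    refine ⟨m, by omega, hxm.1, lt_of_le_of_ne hxm.2 fun h => ?_⟩
    exact hr.besselWr_ne_zero hj hτ hx hxe (h ▸ hr.eq_zero m)
  · intro m hm
    have h1 := hr.abs_besselQuot_lt hj hτ (show m < n + 1 by omega)
    have h2 := hr.abs_besselQuot_lt hj hτ (show m + 1 < n + 1 by omega)
    have s1 := hr.besselQuot_sign hj m
    have s2 := hr.besselQuot_sign hj (m + 1)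
    set v := besselQuot k τ (r (n + 1)) with hv
    have hsucc := hmono m.lt_succ_self
    have hmem : (-1) ^ m * v ∈ Ioo ((-1) ^ m * besselQuot k τ (r (m + 1)))
        ((-1) ^ m * besselQuot k τ (r m)) := by
      have a0 : |(-1) ^ m * v| = |v| := by simp [abs_mul]
      have a1 : (-1) ^ m * besselQuot k τ (r m) = |besselQuot k τ (r m)| := by
        rw [← abs_of_pos s1]; simp [abs_mul]
      have a2 : -((-1) ^ m * besselQuot k τ (r (m + 1))) = |besselQuot k τ (r (m + 1))| := by
        have : |(-1) ^ (m + 1) * besselQuot k τ (r (m + 1))| = |besselQuot k τ (r (m + 1))| := by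
          simp [abs_mul]
        rw [← this, abs_of_pos s2, pow_succ]
        ring
      constructor
      · linarith [neg_abs_le ((-1) ^ m * v)]
      · linarith [le_abs_self ((-1) ^ m * v)]
    obtain ⟨x, hx, hxe⟩ := intermediate_value_Ioo' hsucc.le
      ((continuous_besselQuot k τ).const_mul ((-1) ^ m)).continuousOn hmem
    have hxv : besselQuot k τ x = v := mul_left_cancel₀ (by simp) hxe
    refine ⟨x, ⟨hx, ⟨(hr.nonneg hj m).trans_lt hx.1, hx.2.trans (hmono (by omega))⟩, hxv⟩, ?_⟩
    rintro y ⟨hy, -, hyv⟩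
    exact hr.besselQuot_injOn hj m (Ioo_subset_Icc_self hy) (Ioo_subset_Icc_self hx)
      (hyv.trans hxv.symm)

end

/-- An antiderivative of `x ^ (2k+1) y'(x) ^ 2`, where
`y x = c * besselNorm (-1) k x + d * besselNorm 1 k (τ x)`. -/
noncomputable def besselDirichlet (k : ℕ) (τ c d x : ℝ) : ℝ :=
  x ^ (2 * k + 1) *
    ((c * besselNorm (-1) k x + d * besselNorm 1 k (τ * x)) *
        (c * besselNormD (-1) k x + d * (τ * besselNormD 1 k (τ * x))) +
      c ^ 2 / 2 * (x * besselNormD (-1) k x ^ 2 + x * besselNorm (-1) k x ^ 2 +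
        2 * k * (besselNorm (-1) k x * besselNormD (-1) k x)) +
      d ^ 2 / 2 * (x * (τ * besselNormD 1 k (τ * x)) ^ 2 - τ ^ 2 * x * besselNorm 1 k (τ * x) ^ 2 +
        2 * k * (besselNorm 1 k (τ * x) * (τ * besselNormD 1 k (τ * x)))) +
      c * d * (1 - τ ^ 2) / (1 + τ ^ 2) * besselWr k τ x)

lemma hasDerivAt_besselDirichlet (k : ℕ) {τ x : ℝ} (c d : ℝ) (hτ : τ ≠ 0) (hx : x ≠ 0) :
    HasDerivAt (besselDirichlet k τ c d) (x ^ (2 * k + 1) *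
      (c * besselNormD (-1) k x + d * (τ * besselNormD 1 k (τ * x))) ^ 2) x := by
  have hu := hasDerivAt_besselNorm (-1) k x
  have hu' := hasDerivAt_besselNormD (-1) k hx
  have hv := hasDerivAt_besselNorm_mul 1 k τ x
  have hv' := hasDerivAt_besselNormD_mul 1 k hτ hx
  have hx' := hasDerivAt_id x
  have hω : 1 + τ ^ 2 ≠ 0 := by positivity
  refine ((hasDerivAt_pow (2 * k + 1) x).mul
    ((((((hu.const_mul c).add (hv.const_mul d)).mul ((hu'.const_mul c).add (hv'.const_mul d))).add
      ((((hx'.mul (hu'.pow 2)).add (hx'.mul (hu.pow 2))).add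
        ((hu.mul hu').const_mul (2 * (k : ℝ)))).const_mul (c ^ 2 / 2))).add
      ((((hx'.mul (hv'.pow 2)).sub ((hx'.const_mul (τ ^ 2)).mul (hv.pow 2))).add
        ((hv.mul hv').const_mul (2 * (k : ℝ)))).const_mul (d ^ 2 / 2))).add
      ((hasDerivAt_besselWr k hτ hx).const_mul (c * d * (1 - τ ^ 2) / (1 + τ ^ 2))))).congr_deriv ?_
  simp only [Pi.mul_apply, Pi.add_apply, Pi.sub_apply, Pi.pow_apply, id, besselWr,
    Nat.add_sub_cancel]
  generalize besselNorm 1 k (τ * x) = V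
  generalize besselNormD 1 k (τ * x) = V'
  generalize besselNorm (-1) k x = U
  generalize besselNormD (-1) k x = U'
  rw [pow_succ x (2 * k)]
  push_cast
  field_simp
  ring

lemma continuous_besselDirichlet (k : ℕ) (τ c d : ℝ) : Continuous (besselDirichlet k τ c d) := by
  have h1 := continuous_besselNorm (-1) k
  have h2 := continuous_besselNormD (-1) k
  have h3 := continuous_besselNorm_mul 1 k τ
  have h4 := continuous_besselNormD_mul 1 k τ
  have h5 := continuous_besselWr k τ
  unfold besselDirichlet
  fun_prop

lemma besselDirichlet_pos {k : ℕ} {j : ℕ → ℝ} (hj : IsZeroSeq k j) {τ α c d : ℝ} (hτ : 0 < τ)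
    (hα : j 1 < α) (hd : d ≠ 0)
    (hy : c * besselNorm (-1) k α + d * besselNorm 1 k (τ * α) = 0) :
    0 < besselDirichlet k τ c d α := by
  have hj1 := hj.pos_succ 0
  have hα0 : 0 < α := hj1.trans hα
  set S := besselDirichlet k τ c d with hS
  have hScont : Continuous S := continuous_besselDirichlet k τ c d
  have hS0 : S 0 = 0 := by simp [hS, besselDirichlet]
  have hmono : MonotoneOn S (Icc 0 α) := by
    refine monotoneOn_of_hasDerivWithinAt_nonneg (convex_Icc _ _) hScont.continuousOn
      (fun x hx => (hasDerivAt_besselDirichlet k c d hτ.ne' (x := x) ?_).hasDerivWithinAt)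
      fun x hx => ?_
    · rw [interior_Icc] at hx
      exact hx.1.ne'
    · rw [interior_Icc] at hx
      have := hx.1.le
      positivity
  by_contra! hle
  have hconst : ∀ x ∈ Icc 0 α, S x = 0 := fun x hx =>
    le_antisymm ((hmono hx (right_mem_Icc.2 hα0.le) hx.2).trans hle)
      (hS0 ▸ hmono (left_mem_Icc.2 hα0.le) hx hx.1)
  set y : ℝ → ℝ := fun x => c * besselNorm (-1) k x + d * besselNorm 1 k (τ * x) with hydef
  have hyd : ∀ x, HasDerivAt y
      (c * besselNormD (-1) k x + d * (τ * besselNormD 1 k (τ * x))) x := fun x =>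
    ((hasDerivAt_besselNorm (-1) k x).const_mul c).add
      ((hasDerivAt_besselNorm_mul 1 k τ x).const_mul d)
  have hy' : ∀ x ∈ Ioo 0 α, c * besselNormD (-1) k x + d * (τ * besselNormD 1 k (τ * x)) = 0 := by
    intro x hx
    have hloc : S =ᶠ[𝓝 x] fun _ => 0 := by
      filter_upwards [Icc_mem_nhds hx.1 hx.2] with w hw using hconst w hw
    have h := (hasDerivAt_besselDirichlet k c d hτ.ne' hx.1.ne').unique
      ((hasDerivAt_const x _).congr_of_eventuallyEq hloc)
    simpa [hx.1.ne'] using h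
  obtain ⟨z, hz, hz0⟩ := exists_hasDerivAt_eq_slope y _ hα
    (fun x _ => (hyd x).continuousAt.continuousWithinAt) (fun x _ => hyd x)
  rw [hy' z ⟨hj1.trans hz.1, hz.2⟩, eq_comm, div_eq_zero_iff] at hz0
  have hne : α - j 1 ≠ 0 := (sub_pos.2 hα).ne'
  have hyj : y α = y (j 1) := sub_eq_zero.1 (hz0.resolve_right hne)
  rw [hydef] at hyj
  simp only [hy, hj.eq_zero 0, mul_zero, zero_add] at hyj
  exact mul_ne_zero hd (besselNorm_one_pos k _).ne' hyj.symm

/-- `bucklingF` without its positive factor `(α / 2) ^ k * (κ / α / 2) ^ k`. -/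
noncomputable def bucklingNorm (κ : ℝ) (k : ℕ) (α : ℝ) : ℝ :=
  besselNorm (-1) k α * (κ / α * besselNormD 1 k (κ / α)) -
    besselNorm 1 k (κ / α) * (α * besselNormD (-1) k α)

lemma bucklingF_eq {κ : ℝ} (hκ : 0 < κ) (k : ℕ) {α : ℝ} (hα : 0 < α) :
    bucklingF κ k α = (α / 2) ^ k * (κ / α / 2) ^ k * bucklingNorm κ k α := by
  have hβ : κ / α ≠ 0 := (div_pos hκ hα).ne'
  rw [bucklingF, deriv_besselI k hβ, deriv_besselJ k hα.ne', besselJ_eq, besselI_eq, bucklingNorm]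
  generalize hβe : κ / α = β at *
  field_simp
  ring

lemma bucklingF_eq_zero_iff {κ : ℝ} (hκ : 0 < κ) (k : ℕ) {α : ℝ} (hα : 0 < α) :
    bucklingF κ k α = 0 ↔ bucklingNorm κ k α = 0 := by
  rw [bucklingF_eq hκ k hα, mul_eq_zero, or_iff_right]
  have := div_pos hκ hα
  positivity

lemma bucklingNorm_eq (κ : ℝ) (k : ℕ) {α : ℝ} (hα : α ≠ 0) :
    bucklingNorm κ k α = α * besselWr k (κ / α ^ 2) α := by
  have e : κ / α ^ 2 * α = κ / α := by field_simp
  rw [bucklingNorm, besselWr, e]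
  field_simp

lemma hasDerivAt_bucklingNorm {κ : ℝ} (hκ : 0 < κ) (k : ℕ) {α : ℝ} (hα : 0 < α) :
    HasDerivAt (bucklingNorm κ k)
      ((2 * (α * besselNormD (-1) k α) * (κ / α * besselNormD 1 k (κ / α)) +
        2 * k * (besselNorm (-1) k α * (κ / α * besselNormD 1 k (κ / α)) +
          besselNorm 1 k (κ / α) * (α * besselNormD (-1) k α)) +
        (α ^ 2 - (κ / α) ^ 2) * (besselNorm (-1) k α * besselNorm 1 k (κ / α))) / α) α := by
  have hβ : κ / α ≠ 0 := (div_pos hκ hα).ne'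
  have hα' := hα.ne'
  have hb : HasDerivAt (fun x => κ / x) (-(κ / α) / α) α := by
    refine ((hasDerivAt_const α κ).div (hasDerivAt_id α) hα').congr_deriv ?_
    simp only [id]
    field_simp
    ring
  have hv := (hasDerivAt_besselNorm 1 k (κ / α)).comp α hb
  have hv' := (hasDerivAt_besselNormD 1 k hβ).comp α hb
  refine (((hasDerivAt_besselNorm (-1) k α).mul (hb.mul hv')).sub
    (hv.mul ((hasDerivAt_id α).mul (hasDerivAt_besselNormD (-1) k hα')))).congr_deriv ?_
  simp only [Pi.mul_apply, Function.comp_apply, id]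
  generalize besselNorm 1 k (κ / α) = V
  generalize besselNormD 1 k (κ / α) = V'
  field_simp
  ring

lemma exists_bucklingNorm_zeroSeq {κ : ℝ} (hκ : 0 < κ) {k : ℕ} {j : ℕ → ℝ} (hj : IsZeroSeq k j) :
    ∃ r, IsInterlacedZeroSeq j (bucklingNorm κ k) r := by
  refine exists_isInterlacedZeroSeq hj (fun x hx => hasDerivAt_bucklingNorm hκ k hx)
    (fun x hx => ?_) (fun m => ?_) fun α hα h0 hne => ?_
  · rw [bucklingNorm_eq κ k hx.1.ne']
    exact mul_pos hx.1 (hj.besselWr_pos (div_pos hκ (pow_pos hx.1 2)) x hx)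
  · have hp := hj.pos_succ m
    rw [bucklingNorm_eq κ k hp.ne']
    have := mul_pos hp (hj.besselWr_sign (κ / j (m + 1) ^ 2) m)
    linarith
  · have hα0 : 0 < α := (hj.pos_succ 0).trans hα
    have e : κ / α ^ 2 * α = κ / α := by field_simp
    have hτ : 0 < κ / α ^ 2 := by positivity
    have hpos := besselDirichlet_pos hj (c := besselNorm 1 k (κ / α)) hτ hα (neg_ne_zero.2 hne)
      (by rw [e]; ring)
    have hW : besselWr k (κ / α ^ 2) α = 0 := by
      have h := bucklingNorm_eq κ k hα0.ne'
      rw [h0, zero_eq_mul] at h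
      exact h.resolve_left hα0.ne'
    rw [besselDirichlet, hW, mul_zero, add_zero, e] at hpos
    have h1 := (mul_pos_iff_of_pos_left (pow_pos hα0 _)).1 hpos
    have hV := besselNorm_one_pos k (κ / α)
    rw [bucklingNorm] at h0
    rw [← mul_div_assoc]
    refine div_pos ((mul_pos_iff_of_pos_left hV).1 ?_) hα0
    refine (mul_pos (mul_pos two_pos hα0) h1).trans_eq ?_
    have e2 : κ / α ^ 2 = κ / α / α := by rw [pow_two, div_div]
    rw [e2]
    generalize κ / α = β at *
    field_simp
    linear_combination (besselNorm (-1) k α * (β * besselNormD 1 k β) -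
      besselNorm 1 k β * (α * besselNormD (-1) k α)) * h0

lemma IsInterlacedZeroSeq.of_pos_iff {j r : ℕ → ℝ} {f g : ℝ → ℝ} (hr : IsInterlacedZeroSeq j f r)
    (hpos : ∀ m, 0 < r (m + 1)) (h : ∀ x, 0 < x → (g x = 0 ↔ f x = 0)) :
    IsInterlacedZeroSeq j g r :=
  ⟨hr.zero, hr.mem, fun m => (h _ (hpos m)).2 (hr.eq_zero m),
    fun x hx hx0 => hr.exists_eq x hx ((h x hx).1 hx0)⟩

lemma radialProfile_eq {κ α c d : ℝ} {k : ℕ} (hα : α ≠ 0)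
    (h : c * besselJ k α + d * besselI k (κ / α) = 0) (r : ℝ) :
    radialProfile κ k α c d r = c * (α / 2) ^ k * r ^ k * besselNorm 1 k (κ / α ^ 2 * (α * r)) *
      (besselQuot k (κ / α ^ 2) (α * r) - besselQuot k (κ / α ^ 2) α) := by
  have e : κ / α ^ 2 * α = κ / α := by field_simp
  have e' : κ / α ^ 2 * (α * r) = κ / α * r := by rw [← mul_assoc, e]
  have hV := (besselNorm_one_pos k (κ / α)).ne'
  have hVr := (besselNorm_one_pos k (κ / α * r)).ne'
  rw [besselJ_eq, besselI_eq] at h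
  rw [radialProfile, besselJ_eq, besselI_eq, besselQuot, besselQuot, e, e',
    mul_div_right_comm α r 2, mul_div_right_comm (κ / α) r 2, mul_pow, mul_pow]
  generalize κ / α = β at *
  generalize (β / 2) ^ k = B at *
  generalize (α / 2) ^ k = A at *
  generalize besselNorm 1 k (β * r) = W at *
  field_simp
  linear_combination r ^ k * W * h

theorem theorem4p6 (κ : ℝ) (hκ : 0 < κ) (k ℓ : ℕ) (hℓ : 1 ≤ ℓ) :
    IsNthPositiveRoot (bucklingF κ k) ℓ (alphaRoot κ k ℓ) ∧
    ∀ c d : ℝ, (c, d) ≠ (0, 0) → BoundaryConditions κ k (alphaRoot κ k ℓ) c d →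
      {r : ℝ | r ∈ Set.Ioo 0 1 ∧ radialProfile κ k (alphaRoot κ k ℓ) c d r = 0}.encard
          = ((ℓ - 1 : ℕ) : ℕ∞) ∧
      ∀ r ∈ Set.Ioo (0 : ℝ) 1, radialProfile κ k (alphaRoot κ k ℓ) c d r = 0 →
        deriv (radialProfile κ k (alphaRoot κ k ℓ) c d) r ≠ 0 := by
  obtain ⟨n, rfl⟩ : ∃ n, ℓ = n + 1 := ⟨ℓ - 1, by omega⟩
  obtain ⟨j, hj⟩ := exists_isZeroSeq k
  obtain ⟨a, ha⟩ := exists_bucklingNorm_zeroSeq hκ hj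
  have haF : IsInterlacedZeroSeq j (bucklingF κ k) a :=
    ha.of_pos_iff (fun m => (hj.pos_succ m).trans (ha.mem m).1)
      fun x hx => bucklingF_eq_zero_iff hκ k hx
  have hroot := haF.isNthPositiveRoot hj n
  rw [alphaRoot_eq hroot]
  refine ⟨hroot, ?_⟩
  set α := a (n + 1) with hαdef
  have hα : 0 < α := hroot.1
  set τ := κ / α ^ 2 with hτdef
  have hτ : 0 < τ := by positivity
  obtain ⟨r, hr⟩ := hj.exists_besselWr_zeroSeq hτ
  have hW : besselWr k τ α = 0 := by
    have h := bucklingNorm_eq κ k hα.ne'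
    rw [hαdef, ha.eq_zero n, zero_eq_mul] at h
    exact h.resolve_left hα.ne'
  have hrα : r (n + 1) = α := by
    obtain ⟨m, hm⟩ := hr.exists_eq α hα hW
    have h1 := hr.mem m
    have h2 := ha.mem n
    rw [← hm] at h1
    have a1 := hj.strictMono.lt_iff_lt.1 (h1.1.trans h2.2)
    have a2 := hj.strictMono.lt_iff_lt.1 (h2.1.trans h1.2)
    rw [hm, show m = n by omega]
  rintro c d hcd ⟨hbc, -⟩
  have hc : c ≠ 0 := by
    rintro rfl
    have hβ := div_pos hκ hα
    have hI : besselI k (κ / α) ≠ 0 := by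
      rw [besselI_eq]
      exact mul_ne_zero (by positivity) (besselNorm_one_pos k _).ne'
    refine hcd ?_
    simpa [hI] using hbc
  have hR := radialProfile_eq hα.ne' hbc
  have hzero : ∀ x ∈ Ioo (0 : ℝ) 1, radialProfile κ k α c d x = 0 ↔
      besselQuot k τ (α * x) = besselQuot k τ α := by
    intro x hx
    have hV := besselNorm_one_pos k (τ * (α * x))
    have hx0 := hx.1
    rw [hR, mul_eq_zero, or_iff_right (by positivity), sub_eq_zero]
  constructor
  · have h := hr.encard_besselQuot_eq hj hτ n
    rw [hrα] at h
    rw [Nat.add_sub_cancel, ← h, ← (mul_right_injective₀ hα.ne').encard_image]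
    congr 1
    ext x
    constructor
    · rintro ⟨z, ⟨hz, hz0⟩, rfl⟩
      exact ⟨⟨mul_pos hα hz.1, mul_lt_of_lt_one_right hα hz.2⟩, (hzero z hz).1 hz0⟩
    · rintro ⟨hx, hx0⟩
      have hmem : x / α ∈ Ioo (0 : ℝ) 1 := ⟨div_pos hx.1 hα, (div_lt_one hα).2 hx.2⟩
      have e : α * (x / α) = x := mul_div_cancel₀ x hα.ne'
      exact ⟨x / α, ⟨hmem, (hzero _ hmem).2 (by rw [e]; exact hx0)⟩, e⟩
  · intro x hx hx0
    have hq := (hzero x hx).1 hx0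
    have hxα : α * x ∈ Ioo 0 (r (n + 1)) := by
      rw [hrα]
      exact ⟨mul_pos hα hx.1, mul_lt_of_lt_one_right hα hx.2⟩
    have hWx := hr.besselWr_ne_zero hj hτ hxα (by rw [hrα]; exact hq)
    have hV := besselNorm_one_pos k (τ * (α * x))
    have hlin : HasDerivAt (fun x : ℝ => α * x) α x := by
      simpa using (hasDerivAt_id x).const_mul α
    have hd1 := ((hasDerivAt_besselQuot k τ (α * x)).comp x hlin).sub_const (besselQuot k τ α)
    have hd2 := ((hasDerivAt_pow k x).const_mul (c * (α / 2) ^ k)).mul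
      ((hasDerivAt_besselNorm_mul 1 k τ (α * x)).comp x hlin)
    have hd : HasDerivAt (radialProfile κ k α c d) _ x :=
      (hd2.mul hd1).congr_of_eventuallyEq (Eventually.of_forall hR)
    rw [hd.deriv]
    simp only [Pi.mul_apply, Function.comp_apply, hq, sub_self, mul_zero, zero_add]
    have hx1 := hx.1
    have hxk : x ^ k ≠ 0 := by positivity
    have hαk : (α / 2) ^ k ≠ 0 := by positivity
    exact mul_ne_zero (mul_ne_zero (mul_ne_zero (mul_ne_zero hc hαk) hxk) hV.ne')
      (mul_ne_zero (div_ne_zero (neg_ne_zero.2 hWx) (pow_ne_zero 2 hV.ne')) hα.ne')
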